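/- Let $M:\mathbb{R}^l\times\mathbb{R}^n\rightrightarrows\mathbb{R}^m$ be a multifunction with closed graph, let $S(p):=\{x\in\mathbb{R}^n : 0\in M(p,x)\}$ for $p\in\mathbb{R}^l$, and let $(\bar p,\bar x)$ satisfy $0\in M(\bar p,\bar x)$. All spaces and their products carry the Euclidean norm and inner product. Definitions. For a set $A\subset\mathbb{R}^s$ and $x\in A$, the tangent cone is $T_A(x):=\operatorname{Limsup}_{t\searrow0}(A-x)/t$ and the regular normal cone is $\hat N_A(x):=T_A(x)^\circ$ (negative polar cone), while $\hat N_A(x):=\emptyset$ for $x\notin A$; the directional limiting normal cone in direction $w$ is $N_A(x;w):=\operatorname{Limsup}_{t\searrow0,\,w'\to w}\hat N_A(x+tw')$. Here $\operatorname{Limsup}$ is the outer set limit in the sense of Painlevé–Kuratowski. For a multifunction $\mathcal M:\mathbb{R}^s\rightrightarrows\mathbb{R}^d$ with graph $\operatorname{gph}\mathcal M$ and $y\in\mathcal M(x)$, the graphical derivative is $D\mathcal M(x,y)(w):=\{z : (w,z)\in T_{\operatorname{gph}\mathcal M}(x,y)\}$, and the directional limiting coderivative in direction $(w,z)$ is $D^*\mathcal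 M((x,y);(w,z))(y^*):=\{x^* : (x^*,-y^*)\in N_{\operatorname{gph}\mathcal M}((x,y);(w,z))\}$. Assume that for every $q\in\mathbb{R}^l$ there is some $u\in\mathbb{R}^n$ with $0\in DM(\bar p,\bar x,0)(q,u)$, and that for every $(q,u)\in\mathbb{R}^l\times\mathbb{R}^n$ with $(q,u)\neq(0,0)$ and $0\in DM(\bar p,\bar x,0)(q,u)$, and all $q^*\in\mathbb{R}^l$, $v^*\in\mathbb{R}^m$, the implication $$(q^*,0)\in D^*M((\bar p,\bar x,0);(q,u,0))(v^*)\ \Longrightarrow\ q^*=0,\ v^*=0$$ holds. Then $S$ has the Aubin property around $(\bar p,\bar x)$, that is, there are $\kappa\ge0$ and $\varepsilon>0$ such that $$\operatorname{dist}(x,S(p))\le\kappa\,\|p'-p\|\quad\text{whenever } \|p-\bar p\|<\varepsilon,\ \|x-\bar x\|<\varepsilon,\ p'\in\mathbb{R}^l,\ x\in S(p')$$ (with $\operatorname{dist}(x,\emptyset)=\infty$), and $$DS(\bar p,\bar x)(q)=\{u\in\mathbb{R}^n : 0\in DM(\bar p,\bar x,0)(q,u)\}\quad\text{for all } q\in\mathbb{R}^l.$$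 -/

import Mathlib

open Filter Topology
open scoped NNReal ENNReal

/-- The outer (upper) set limit in the sense of Painlevé–Kuratowski of the set-valued map `F`
along the filter `l`: all limits of sequences `w k ∈ F (a k)` with `a k → l`. -/
def outerLimit {α E : Type*} [TopologicalSpace E] (l : Filter α) (F : α → Set E) : Set E :=
  {z | ∃ (a : ℕ → α) (w : ℕ → E),
    Tendsto a atTop l ∧ (∀ k, w k ∈ F (a k)) ∧ Tendsto w atTop (𝓝 z)}

section Cones

variable {E : Type*} [NormedAddCommGroup E] [InnerProductSpace ℝ E]

/-- The tangent (contingent) cone `Limsup_{t ↘ 0} (A - x) / t`. -/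
def contingentCone (A : Set E) (x : E) : Set E :=
  outerLimit (𝓝[>] (0 : ℝ)) fun t => {w | ∃ a ∈ A, w = t⁻¹ • (a - x)}

/-- The (negative) polar cone. -/
def negPolar (K : Set E) : Set E :=
  {v | ∀ w ∈ K, inner ℝ v w ≤ 0}

/-- The regular (Fréchet) normal cone: the polar of the tangent cone at points of `A`, and empty
at points outside `A`. -/
def regularNormalCone (A : Set E) (x : E) : Set E :=
  {v | x ∈ A ∧ v ∈ negPolar (contingentCone A x)}

/-- The directional limiting normal cone to `A` at `x` in direction `u`,
`Limsup_{t ↘ 0, u' → u} N̂_A (x + t u')`. -/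
def dirNormalCone (A : Set E) (x u : E) : Set E :=
  outerLimit (𝓝[>] (0 : ℝ) ×ˢ 𝓝 u) fun tu => regularNormalCone A (x + tu.1 • tu.2)

end Cones

section Multifunctions

variable {E F : Type*} [NormedAddCommGroup E] [InnerProductSpace ℝ E]
  [NormedAddCommGroup F] [InnerProductSpace ℝ F]

/-- The graph of a multifunction, in the product with the Euclidean structure. -/
def mfGraph (M : E → Set F) : Set (WithLp 2 (E × F)) :=
  {z | z.snd ∈ M z.fst}

/-- The graphical derivative `DM(x, y)(u)`. -/
def graphicalDerivative (M : E → Set F) (x : E) (y : F) (u : E) : Set F :=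
  {v | WithLp.toLp 2 (u, v) ∈ contingentCone (mfGraph M) (WithLp.toLp 2 (x, y))}

/-- The directional limiting coderivative `D*M((x, y); (u, v))(y')` in direction `(u, v)`. -/
def dirCoderivative (M : E → Set F) (x : E) (y : F) (u : E) (v : F) (y' : F) : Set E :=
  {x' | WithLp.toLp 2 (x', -y') ∈
    dirNormalCone (mfGraph M) (WithLp.toLp 2 (x, y)) (WithLp.toLp 2 (u, v))}

end Multifunctions

/-- The Aubin property of `F` around `(y₀, x₀)`. The distance is `ℝ≥0∞`-valued, so that the
distance to the empty set is `∞`. -/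
def HasAubinProperty {Y X : Type*} [PseudoMetricSpace Y] [PseudoMetricSpace X]
    (F : Y → Set X) (y₀ : Y) (x₀ : X) : Prop :=
  x₀ ∈ F y₀ ∧ ∃ κ : ℝ≥0, ∃ ε : ℝ, 0 < ε ∧ ∀ (y v : Y) (x : X),
    dist y y₀ < ε → dist x x₀ < ε → x ∈ F v → Metric.infEDist x (F y) ≤ κ * edist v y

/-- The implicit multifunction `S(p) = {x | 0 ∈ M(p, x)}` of a multifunction `M` of two variables. -/
def implicitMap {P X Y : Type*} [Zero Y] (M : WithLp 2 (P × X) → Set Y) (p : P) : Set X :=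
  {x | 0 ∈ M (WithLp.toLp 2 (p, x))}

/-! ### Regular normals under directional nondegeneracy, and a variational principle. -/

section DirectionalNondegeneracy

variable {E F : Type*} [NormedAddCommGroup E] [InnerProductSpace ℝ E]
  [NormedAddCommGroup F] [InnerProductSpace ℝ F]

/-! Let `G` be the graph of `M`, with points `z = (p, x, y)`, and let `P` delete the `x`-component:
a point `z` of `G` with `P (z - (p', x, 0)) = 0` is a solution over `p'`. By compactness, the
coderivative condition says that at points of `G` near the reference point `z₀`, with `y` small
relative to `‖z - z₀‖`, the `x`-component of a regular normal dominates its norm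
(`exists_norm_le_of_dirNormalCone`). A minimiser of the residual plus a quadratic penalty would
otherwise carry a normal lying almost in the range of `P`, so the equation is solvable with a linear
estimate whenever the residual is small relative to the distance to `z₀`
(`exists_mem_apply_eq_of_dirNormalCone`).

With `p' = p` this corrects approximate solutions and gives the formula for `DS`. With `y = 0` it
moves solutions under parameter shifts that are small relative to the distance to the reference
point (`IsLocallyMovable`). Larger shifts only need some solution over `p` within `C * ‖p - p₀‖` of
`x₀`. Tangential solutions give starting points arbitrarily close to the reference point; these are
followed outwards along rays in geometric steps, and compactness of the unit sphere covers all
directions (`exists_forall_calm`). -/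

/-- Proximal normals are regular normals. -/
theorem neg_mem_regularNormalCone_of_quadratic {G : Set E} {x v : E} {C : ℝ} (hx : x ∈ G)
    (h : ∀ z ∈ G, 0 ≤ inner ℝ v (z - x) + C * ‖z - x‖ ^ 2) : -v ∈ regularNormalCone G x := by
  refine ⟨hx, ?_⟩
  rintro w ⟨t, w', ht, hw', hlim⟩
  rw [inner_neg_left, neg_nonpos]
  obtain ⟨ht0, htpos⟩ := tendsto_nhdsWithin_iff.1 ht
  have hL : Tendsto (fun k => inner ℝ v (w' k) + C * (t k * ‖w' k‖ ^ 2)) atTop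
      (𝓝 (inner ℝ v w + C * (0 * ‖w‖ ^ 2))) :=
    (tendsto_const_nhds.inner hlim).add ((ht0.mul (hlim.norm.pow 2)).const_mul C)
  rw [zero_mul, mul_zero, add_zero] at hL
  refine ge_of_tendsto hL (htpos.mono fun k (hk : 0 < t k) => ?_)
  obtain ⟨a, ha, hwa⟩ := hw' k
  have h1 : a - x = t k • w' k := by rw [hwa, smul_inv_smul₀ hk.ne']
  have h2 := h a ha
  rw [h1, inner_smul_right, norm_smul, Real.norm_of_nonneg hk.le] at h2
  have h3 : 0 ≤ t k * (inner ℝ v (w' k) + C * (t k * ‖w' k‖ ^ 2)) := by nlinarith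
  exact nonneg_of_mul_nonneg_right h3 hk

theorem smul_mem_regularNormalCone {G : Set E} {x v : E} {s : ℝ} (hs : 0 ≤ s)
    (hv : v ∈ regularNormalCone G x) : s • v ∈ regularNormalCone G x := by
  refine ⟨hv.1, fun w hw => ?_⟩
  rw [real_inner_smul_left]
  exact mul_nonpos_of_nonneg_of_nonpos hs (hv.2 w hw)

/-- If no nonzero directional limiting normal is annihilated by `B`, in the tangent directions
annihilated by `A`, then regular normals at nearby points in nearby directions are controlled
by their image under `B`. -/
theorem exists_norm_le_of_dirNormalCone [FiniteDimensional ℝ E] {H : Type*}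
    [NormedAddCommGroup H] [InnerProductSpace ℝ H] (A : E →ₗ[ℝ] F) (B : E →ₗ[ℝ] H)
    {G : Set E} {z₀ : E}
    (hG : ∀ w ∈ contingentCone G z₀, w ≠ 0 → A w = 0 →
      ∀ μ ∈ dirNormalCone G z₀ w, B μ = 0 → μ = 0) :
    ∃ δ > 0, ∀ z ∈ G, z ≠ z₀ → ‖z - z₀‖ < δ → ‖A (z - z₀)‖ ≤ δ * ‖z - z₀‖ →
      ∀ ν ∈ regularNormalCone G z, δ * ‖ν‖ ≤ ‖B ν‖ := by
  have : ProperSpace E := FiniteDimensional.proper_real E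
  have hA : Continuous A := A.continuous_of_finiteDimensional
  have hB : Continuous B := B.continuous_of_finiteDimensional
  by_contra! hcon
  have hδ : ∀ k : ℕ, (0 : ℝ) < 1 / ((k : ℝ) + 1) := fun k => Nat.one_div_pos_of_nat
  have hδ0 : Tendsto (fun k : ℕ => 1 / ((k : ℝ) + 1)) atTop (𝓝 0) :=
    tendsto_one_div_add_atTop_nhds_zero_nat
  choose z hzG hz hzδ hAz ν hν hBν using fun k : ℕ => hcon _ (hδ k)
  have hνpos : ∀ k, 0 < ‖ν k‖ := fun k =>
    pos_of_mul_pos_right ((norm_nonneg _).trans_lt (hBν k)) (hδ k).le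
  have hzpos : ∀ k, 0 < ‖z k - z₀‖ := fun k => norm_pos_iff.2 (sub_ne_zero.2 (hz k))
  set w : ℕ → E := fun k => ‖z k - z₀‖⁻¹ • (z k - z₀) with hw
  set μ : ℕ → E := fun k => ‖ν k‖⁻¹ • ν k with hμ
  have hw1 : ∀ k, ‖w k‖ = 1 := fun k => norm_smul_inv_norm (𝕜 := ℝ) (norm_pos_iff.1 (hzpos k))
  have hμ1 : ∀ k, ‖μ k‖ = 1 := fun k => norm_smul_inv_norm (𝕜 := ℝ) (norm_pos_iff.1 (hνpos k))
  obtain ⟨⟨w', μ'⟩, hmem, φ, hφ, hlim⟩ :=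
    ((isCompact_sphere (0 : E) 1).prod (isCompact_sphere (0 : E) 1)).tendsto_subseq
      (x := fun k => (w k, μ k)) (fun k => by simp [hw1, hμ1])
  have hw' : ‖w'‖ = 1 := by simpa using hmem.1
  have hμ' : ‖μ'‖ = 1 := by simpa using hmem.2
  have hlimw : Tendsto (fun k => w (φ k)) atTop (𝓝 w') := (continuous_fst.tendsto _).comp hlim
  have hlimμ : Tendsto (fun k => μ (φ k)) atTop (𝓝 μ') := (continuous_snd.tendsto _).comp hlim
  have hδφ := hδ0.comp hφ.tendsto_atTop
  have ht : Tendsto (fun k => ‖z (φ k) - z₀‖) atTop (𝓝[>] 0) :=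
    tendsto_nhdsWithin_iff.2 ⟨squeeze_zero (fun k => norm_nonneg _) (fun k => (hzδ (φ k)).le) hδφ,
      Eventually.of_forall fun k => hzpos (φ k)⟩
  have hzw : ∀ k, z₀ + ‖z k - z₀‖ • w k = z k := fun k => by
    rw [hw, smul_inv_smul₀ (hzpos k).ne', add_sub_cancel]
  have hAw : A w' = 0 := by
    refine norm_eq_zero.1 (le_antisymm (le_of_tendsto_of_tendsto
      ((hA.tendsto _).comp hlimw).norm hδφ (Eventually.of_forall fun k => ?_)) (norm_nonneg _))
    have := hAz (φ k)
    simp only [Function.comp, hw, map_smul, norm_smul, norm_inv, norm_norm]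
    rwa [inv_mul_le_iff₀ (hzpos _), mul_comm]
  have hBμ : B μ' = 0 := by
    refine norm_eq_zero.1 (le_antisymm (le_of_tendsto_of_tendsto
      ((hB.tendsto _).comp hlimμ).norm hδφ (Eventually.of_forall fun k => ?_)) (norm_nonneg _))
    have := (hBν (φ k)).le
    simp only [Function.comp, hμ, map_smul, norm_smul, norm_inv, norm_norm]
    rwa [inv_mul_le_iff₀ (hνpos _), mul_comm]
  have hμ0 : μ' = 0 := by
    refine hG w' ⟨_, _, ht, fun k => ⟨z (φ k), hzG _, rfl⟩, hlimw⟩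
      (norm_pos_iff.1 (by rw [hw']; exact one_pos)) hAw μ'
      ⟨_, _, ht.prodMk hlimw, fun k => ?_, hlimμ⟩ hBμ
    simp only [hzw]
    exact smul_mem_regularNormalCone (inv_nonneg.2 (norm_nonneg _)) (hν _)
  rw [hμ0, norm_zero] at hμ'
  exact zero_ne_one hμ'

theorem norm_apply_le_of_isSymmetricProjection {P : E →ₗ[ℝ] E} (hP : P.IsSymmetricProjection)
    (x : E) : ‖P x‖ ≤ ‖x‖ := by
  have h1 : P (P x) = P x := LinearMap.congr_fun hP.isIdempotentElem.eq x
  have h2 : inner ℝ (P x) (P x) = inner ℝ (P x) x := by rw [← hP.isSymmetric, h1]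
  have h3 := real_inner_le_norm (P x) x
  rw [← h2, real_inner_self_eq_norm_sq] at h3
  nlinarith [norm_nonneg (P x), norm_nonneg x]

/-- A variational principle: the distance of a point of `G` to the set of solutions of
`P z = P h` in `G` is bounded by the residual, if regular normals at the points with a small
residual are controlled by their component in the kernel of the projection `P`. -/
theorem exists_mem_apply_eq_of_regularNormalCone [FiniteDimensional ℝ E] {P : E →ₗ[ℝ] E}
    (hP : P.IsSymmetricProjection) {G : Set E} (hG : IsClosed G) {z₁ h : E} (hz₁ : z₁ ∈ G)
    {δ σ : ℝ} (hσ : 0 < σ) (hσδ : 2 * σ < δ * (1 - 2 * σ)) (hδ : 0 < δ)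
    (hN : ∀ z ∈ G, ‖P (z - h)‖ ≤ ‖P (z₁ - h)‖ → ‖z - z₁‖ ≤ ‖P (z₁ - h)‖ / σ →
      ∀ ν ∈ regularNormalCone G z, δ * ‖ν‖ ≤ ‖ν - P ν‖) :
    ∃ z ∈ G, P (z - h) = 0 ∧ ‖z - z₁‖ ≤ ‖P (z₁ - h)‖ / σ := by
  have : ProperSpace E := FiniteDimensional.proper_real E
  have hPc : Continuous P := P.continuous_of_finiteDimensional
  have hPP : ∀ x, P (P x) = P x := fun x => LinearMap.congr_fun hP.isIdempotentElem.eq x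
  set r := ‖P (z₁ - h)‖ with hr
  rcases (norm_nonneg (P (z₁ - h))).eq_or_lt with h0 | hrpos
  · exact ⟨z₁, hz₁, norm_eq_zero.1 h0.symm, by
      rw [sub_self, norm_zero]; positivity⟩
  rw [← hr] at hrpos
  -- Chosen so that `τ * (r / σ) ^ 2 = r`, which confines the sublevel set to the ball of radius `r
  -- / σ`, where the penalty has gradient at most `2 * σ`.
  set τ := σ ^ 2 / r with hτ
  have hτpos : 0 < τ := by positivity
  have hτr : τ * (r / σ) = σ := by rw [hτ]; field_simp
  set g : E → ℝ := fun z => ‖P (z - h)‖ + τ * ‖z - z₁‖ ^ 2 with hg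
  have hgc : Continuous g := by fun_prop
  have hg1 : g z₁ = r := by simp [hg, hr]
  have hball : ∀ z, g z ≤ r → ‖z - z₁‖ ≤ r / σ := fun z hz => by
    by_contra! hlt
    have h1 : τ * (r / σ) ^ 2 = r := by rw [hτ]; field_simp
    have h2 : (r / σ) ^ 2 < ‖z - z₁‖ ^ 2 := by gcongr
    have h3 := mul_lt_mul_of_pos_left h2 hτpos
    have h4 := norm_nonneg (P (z - h))
    simp only [hg] at hz
    linarith
  obtain ⟨z, ⟨hzG, -⟩, hzmin⟩ := ((isCompact_closedBall z₁ (r / σ)).inter_left hG).exists_isMinOn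
    ⟨z₁, hz₁, Metric.mem_closedBall_self (by positivity)⟩ hgc.continuousOn
  have hzr : g z ≤ r := hg1 ▸ hzmin ⟨hz₁, Metric.mem_closedBall_self (by positivity)⟩
  have hmin : ∀ y ∈ G, g z ≤ g y := fun y hy => by
    rcases le_or_gt (g y) r with h1 | h1
    · exact hzmin ⟨hy, by rw [mem_closedBall_iff_norm]; exact hball y h1⟩
    · exact hzr.trans h1.le
  refine ⟨z, hzG, ?_, hball z hzr⟩
  by_contra hne
  set a := P (z - h) with ha
  have hapos : 0 < ‖a‖ := norm_pos_iff.2 hne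
  have hPa : P a = a := hPP _
  set d := (2 * τ) • (z - z₁) with hd
  have hdn : ‖d‖ ≤ 2 * σ := by
    rw [hd, norm_smul, Real.norm_of_nonneg (by positivity), mul_assoc, ← hτr]
    gcongr
    exact hball z hzr
  -- The gradient of `g` at its minimiser `z`; `g` is smooth there because the residual `a` is
  -- nonzero.
  have hv : -(‖a‖⁻¹ • a + d) ∈ regularNormalCone G z := by
    refine neg_mem_regularNormalCone_of_quadratic (C := (2 * ‖a‖)⁻¹ + τ) hzG fun y hy => ?_
    have h1 : ‖a‖ + τ * ‖z - z₁‖ ^ 2 ≤ ‖P (y - h)‖ + τ * ‖y - z₁‖ ^ 2 := hmin y hy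
    have h2 : P (y - h) = a + P (y - z) := by rw [ha, ← map_add]; congr 1; abel
    have h3 : ‖P (y - h)‖ ^ 2 = ‖a‖ ^ 2 + 2 * inner ℝ a (y - z) + ‖P (y - z)‖ ^ 2 := by
      rw [h2, norm_add_sq_real, ← hP.isSymmetric, hPa]
    have h4 : ‖y - z₁‖ ^ 2 = ‖z - z₁‖ ^ 2 + 2 * inner ℝ (z - z₁) (y - z) + ‖y - z‖ ^ 2 := by
      rw [← norm_add_sq_real]; congr 2; abel
    have h5 : ‖P (y - z)‖ ^ 2 ≤ ‖y - z‖ ^ 2 := by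
      gcongr; exact norm_apply_le_of_isSymmetricProjection hP _
    have h6 : ‖P (y - h)‖ - ‖a‖ ≤ ‖a‖⁻¹ * inner ℝ a (y - z) + (2 * ‖a‖)⁻¹ * ‖y - z‖ ^ 2 := by
      have : ‖a‖⁻¹ * inner ℝ a (y - z) + (2 * ‖a‖)⁻¹ * ‖y - z‖ ^ 2 =
          (2 * inner ℝ a (y - z) + ‖y - z‖ ^ 2) / (2 * ‖a‖) := by field_simp
      rw [this, le_div_iff₀ (by positivity)]
      nlinarith [sq_nonneg (‖P (y - h)‖ - ‖a‖)]
    rw [inner_add_left, real_inner_smul_left, hd, real_inner_smul_left]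
    rw [h4] at h1
    linarith
  have hga : ‖a‖ ≤ r := by
    have : 0 ≤ τ * ‖z - z₁‖ ^ 2 := by positivity
    have h1 : ‖a‖ + τ * ‖z - z₁‖ ^ 2 ≤ r := hzr
    linarith
  have hb := hN z hzG hga (hball z hzr) _ hv
  have he : ‖‖a‖⁻¹ • a‖ = 1 := norm_smul_inv_norm (𝕜 := ℝ) hne
  have h1 : 1 - 2 * σ ≤ ‖‖a‖⁻¹ • a + d‖ := by
    have := norm_sub_le (‖a‖⁻¹ • a + d) d
    rw [add_sub_cancel_right, he] at this
    linarith
  -- Since `P a = a`, only `d` contributes to the kernel component; `hN` then contradicts `hσδ`.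
  have h2 : ‖-(‖a‖⁻¹ • a + d) - P (-(‖a‖⁻¹ • a + d))‖ ≤ 2 * σ := by
    have h3 : -(‖a‖⁻¹ • a + d) - P (-(‖a‖⁻¹ • a + d)) = -(d - P d) := by
      rw [map_neg, map_add, map_smul, hPa]; abel
    have h4 : ‖d - P d‖ ^ 2 = ‖d‖ ^ 2 - ‖P d‖ ^ 2 := by
      have : inner ℝ d (P d) = ‖P d‖ ^ 2 := by
        rw [← real_inner_self_eq_norm_sq, hP.isSymmetric, hPP]
      rw [norm_sub_sq_real, this]; ring
    rw [h3, norm_neg]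
    refine le_trans (abs_le_of_sq_le_sq' ?_ (norm_nonneg d)).2 hdn
    nlinarith [sq_nonneg ‖P d‖]
  rw [norm_neg] at hb
  have h5 := mul_le_mul_of_nonneg_left h1 hδ.le
  linarith

/-- Under directional nondegeneracy, points of `G` whose residual is small compared to the distance
to the reference point can be corrected with a linear estimate. -/
theorem exists_mem_apply_eq_of_dirNormalCone [FiniteDimensional ℝ E] {P : E →ₗ[ℝ] E}
    (hP : P.IsSymmetricProjection) {A : E →ₗ[ℝ] F} (hA : ∀ x, ‖A x‖ ≤ ‖P x‖)
    {G : Set E} (hG : IsClosed G) {z₀ : E}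
    (hnd : ∀ w ∈ contingentCone G z₀, w ≠ 0 → A w = 0 →
      ∀ μ ∈ dirNormalCone G z₀ w, μ - P μ = 0 → μ = 0) :
    ∃ κ > 0, ∃ η > 0, ∀ z₁ ∈ G, ∀ h, A (h - z₀) = 0 → ‖z₁ - z₀‖ < η →
      ‖P (z₁ - h)‖ ≤ η * ‖z₁ - z₀‖ →
        ∃ z ∈ G, P (z - h) = 0 ∧ ‖z - z₁‖ ≤ κ * ‖P (z₁ - h)‖ := by
  obtain ⟨δ, hδ, H⟩ := exists_norm_le_of_dirNormalCone A (LinearMap.id - P) hnd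
  obtain ⟨σ, hσ, hσδ⟩ : ∃ σ > 0, 2 * σ < δ * (1 - 2 * σ) := by
    refine ⟨δ / (4 * (1 + δ)), by positivity, ?_⟩
    rw [← sub_pos]
    have : δ * (1 - 2 * (δ / (4 * (1 + δ)))) - 2 * (δ / (4 * (1 + δ))) = δ / 2 := by
      field_simp; ring
    rw [this]; positivity
  -- The bound `σ / 2` keeps the search ball within half the distance from `z₁` to `z₀`, hence away
  -- from `z₀`; `δ / 2` compensates for that half in the bound on `A (z - z₀)`.
  refine ⟨1 / σ, by positivity, min (σ / 2) (δ / 2), by positivity, fun z₁ hz₁ h hh hz₁η hr => ?_⟩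
  have h1 : ‖z₁ - z₀‖ < δ / 2 := hz₁η.trans_le (min_le_right _ _)
  have h2 : ‖P (z₁ - h)‖ ≤ σ / 2 * ‖z₁ - z₀‖ := hr.trans (by gcongr; exact min_le_left _ _)
  have h3 : ‖P (z₁ - h)‖ ≤ δ / 2 * ‖z₁ - z₀‖ := hr.trans (by gcongr; exact min_le_right _ _)
  rcases eq_or_ne z₁ z₀ with rfl | hne
  · have : P (z₁ - h) = 0 := norm_le_zero_iff.1 (by simpa using h2)
    exact ⟨z₁, hz₁, this, by simp [this]⟩
  have hpos : 0 < ‖z₁ - z₀‖ := norm_pos_iff.2 (sub_ne_zero.2 hne)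
  simp only [one_div_mul_eq_div]
  refine exists_mem_apply_eq_of_regularNormalCone hP hG hz₁ hσ hσδ hδ fun z hz hzr hzz ν hν => ?_
  have h4 : ‖z - z₁‖ ≤ ‖z₁ - z₀‖ / 2 := hzz.trans (by
    rw [div_le_iff₀ hσ]; linarith)
  have h5 : ‖z₁ - z₀‖ / 2 ≤ ‖z - z₀‖ := by
    have := norm_sub_le_norm_sub_add_norm_sub z₁ z z₀
    rw [norm_sub_rev z₁ z] at this
    linarith
  have h6 : ‖z - z₀‖ < δ := by
    have := norm_sub_le_norm_sub_add_norm_sub z z₁ z₀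
    linarith
  refine H z hz ?_ h6 ?_ ν hν
  · rintro rfl
    rw [sub_self, norm_zero] at h5
    linarith
  · have h7 : A (z - z₀) = A (z - h) := by
      rw [← sub_add_sub_cancel z h z₀, map_add, hh, add_zero]
    rw [h7]
    calc ‖A (z - h)‖ ≤ δ / 2 * ‖z₁ - z₀‖ := (hA _).trans (hzr.trans h3)
      _ ≤ δ * ‖z - z₀‖ := by nlinarith

end DirectionalNondegeneracy

/-! ### Sequential form of the graphical derivative. -/

section GraphicalDerivative

variable {P X : Type*} [NormedAddCommGroup P] [InnerProductSpace ℝ P]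
  [NormedAddCommGroup X] [InnerProductSpace ℝ X]

theorem graphicalDerivative_iff {F : P → Set X} {p₀ : P} {x₀ : X} {q : P} {u : X} :
    u ∈ graphicalDerivative F p₀ x₀ q ↔ ∃ (t : ℕ → ℝ) (q' : ℕ → P) (u' : ℕ → X),
      Tendsto t atTop (𝓝[>] 0) ∧ Tendsto q' atTop (𝓝 q) ∧ Tendsto u' atTop (𝓝 u) ∧
        ∀ k, x₀ + t k • u' k ∈ F (p₀ + t k • q' k) := by
  constructor
  · rintro ⟨t, w, ht, hw, hlim⟩
    -- The step sizes are positive only eventually, so the sequences are shifted by `N`.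
    obtain ⟨N, hN⟩ := eventually_atTop.1 (tendsto_nhdsWithin_iff.1 ht).2
    have hs := tendsto_add_atTop_nat N
    have hlim' := hlim.comp hs
    refine ⟨fun k => t (k + N), fun k => (w (k + N)).fst, fun k => (w (k + N)).snd, ht.comp hs,
      ((WithLp.continuous_fst 2 P X).tendsto _).comp hlim',
      ((WithLp.continuous_snd 2 P X).tendsto _).comp hlim', fun k => ?_⟩
    obtain ⟨a, ha, hwa⟩ := hw (k + N)
    have hk : 0 < t (k + N) := hN _ (Nat.le_add_left _ _)
    have h1 : a = WithLp.toLp 2 (p₀, x₀) + t (k + N) • w (k + N) := by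
      rw [hwa, smul_inv_smul₀ hk.ne', add_sub_cancel]
    rw [h1] at ha
    exact ha
  · rintro ⟨t, q', u', ht, hq, hu, h⟩
    obtain ⟨N, hN⟩ := eventually_atTop.1 (tendsto_nhdsWithin_iff.1 ht).2
    have hs := tendsto_add_atTop_nat N
    refine ⟨fun k => t (k + N), fun k => WithLp.toLp 2 (q' (k + N), u' (k + N)), ht.comp hs,
      fun k => ⟨WithLp.toLp 2 (p₀ + t (k + N) • q' (k + N), x₀ + t (k + N) • u' (k + N)),
        h _, ?_⟩,
      ((WithLp.prod_continuous_toLp 2 P X).tendsto (q, u)).comp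
        ((hq.comp hs).prodMk_nhds (hu.comp hs))⟩
    have hk : 0 < t (k + N) := hN _ (Nat.le_add_left _ _)
    have h1 : WithLp.toLp 2 (p₀ + t (k + N) • q' (k + N), x₀ + t (k + N) • u' (k + N)) -
        WithLp.toLp 2 (p₀, x₀) = t (k + N) • WithLp.toLp 2 (q' (k + N), u' (k + N)) := by
      rw [← WithLp.toLp_sub, ← WithLp.toLp_smul]
      simp
    rw [h1, inv_smul_smul₀ hk.ne']

end GraphicalDerivative

/-! ### From local movability to the Aubin property. -/

section AubinProperty

variable {P X : Type*} [NormedAddCommGroup P] [InnerProductSpace ℝ P] [NormedAddCommGroup X]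

/-- Moving the parameter of `F` by a small fraction of the distance to the reference point
is possible with a linear estimate. -/
def IsLocallyMovable (F : P → Set X) (p₀ : P) (x₀ : X) (κ η : ℝ) : Prop :=
  ∀ p x p', x ∈ F p → ‖p - p₀‖ + ‖x - x₀‖ < η → ‖p - p'‖ ≤ η * (‖p - p₀‖ + ‖x - x₀‖) →
    ∃ x' ∈ F p', ‖x' - x‖ ≤ κ * ‖p - p'‖

namespace IsLocallyMovable

variable {F : P → Set X} {p₀ : P} {x₀ : X} {κ η : ℝ}

/-- Solutions along a ray can be followed away from the reference point. -/
theorem exists_mem_of_mul_le (hF : IsLocallyMovable F p₀ x₀ κ η) (hη : 0 < η) {q : P}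
    (hq : ‖q‖ = 1) {C s : ℝ} (hC : κ ≤ C) (hC0 : 0 ≤ C) (hs : 0 < s)
    (h : ∃ x ∈ F (p₀ + s • q), ‖x - x₀‖ ≤ C * s) (k : ℕ) :
    ∀ t, s ≤ t → t ≤ s * (1 + η) ^ k → (1 + C) * t < η →
      ∃ x ∈ F (p₀ + t • q), ‖x - x₀‖ ≤ C * t := by
  induction k with
  | zero =>
    intro t h1 h2 _
    obtain rfl : t = s := le_antisymm (by simpa using h2) h1
    exact h
  | succ k ih =>
    intro t h1 h2 h3
    have hη1 : 0 < 1 + η := by linarith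
    -- One growth step back from `t`, not below `s`. Moving from `r` to `t` costs `κ * (t - r) ≤ C *
    -- (t - r)`, so `C` does not deteriorate.
    set r := max s (t / (1 + η)) with hr
    have hrs : s ≤ r := le_max_left _ _
    have hrt : r ≤ t := max_le h1 (div_le_self (hs.le.trans h1) (by linarith))
    have htr : t ≤ r * (1 + η) := (div_le_iff₀ hη1).1 (le_max_right _ _)
    have hr0 : 0 < r := hs.trans_le hrs
    obtain ⟨x, hx, hxr⟩ := ih r hrs
      (max_le (le_mul_of_one_le_right hs.le (one_le_pow₀ (by linarith)))
        (by rw [div_le_iff₀ hη1, mul_assoc, ← pow_succ]; exact h2))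
      ((mul_le_mul_of_nonneg_left hrt (by linarith)).trans_lt h3)
    have hp : ‖p₀ + r • q - p₀‖ = r := by
      rw [add_sub_cancel_left, norm_smul, hq, mul_one, Real.norm_of_nonneg hr0.le]
    have hpp : ‖p₀ + r • q - (p₀ + t • q)‖ = t - r := by
      rw [add_sub_add_left_eq_sub, ← sub_smul, norm_smul, hq, mul_one, Real.norm_eq_abs,
        abs_sub_comm, abs_of_nonneg (by linarith)]
    obtain ⟨x', hx', hxx'⟩ := hF _ x (p₀ + t • q) hx (by rw [hp]; nlinarith)
      (by rw [hp, hpp]; nlinarith [norm_nonneg (x - x₀)])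
    refine ⟨x', hx', ?_⟩
    rw [hpp] at hxx'
    have := norm_sub_le_norm_sub_add_norm_sub x' x x₀
    nlinarith

variable [InnerProductSpace ℝ X]

/-- A tangential sequence gives solutions near the ray at arbitrarily small scales. One is moved
onto the ray at a scale below `t`, and finitely many growth steps reach `t` with constants
independent of the starting scale. -/
theorem exists_forall_ray (hF : IsLocallyMovable F p₀ x₀ κ η) (hκ : 0 < κ) (hη : 0 < η) {q : P}
    (hq : ‖q‖ = 1) {u : X} (hu : u ∈ graphicalDerivative F p₀ x₀ q) :
    ∃ C ≥ 0, ∃ ρ > 0, ∀ t, 0 < t → t < ρ → ∃ x ∈ F (p₀ + t • q), ‖x - x₀‖ ≤ C * t := by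
  obtain ⟨s, q', u', hs, hq', hu', hmem⟩ := graphicalDerivative_iff.1 hu
  obtain ⟨hs0, hspos⟩ := tendsto_nhdsWithin_iff.1 hs
  set C := ‖u‖ + 1 + κ with hC
  have hC0 : 0 ≤ C := by positivity
  refine ⟨C, hC0, η / (1 + C), by positivity, fun t ht0 htρ => ?_⟩
  -- The `1 / 2` forces `‖q' k‖ ≥ 1 / 2`, so that `η / 2` is at most `η * ‖q' k‖`.
  have e1 : ∀ᶠ k in atTop, ‖q' k - q‖ < min (η / 2) (1 / 2) :=
    (tendsto_iff_norm_sub_tendsto_zero.1 hq').eventually_lt_const (by positivity)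
  have e2 : ∀ᶠ k in atTop, ‖u' k‖ < ‖u‖ + 1 := hu'.norm.eventually_lt_const (by linarith)
  have e3 : ∀ᶠ k in atTop, s k * (‖q' k‖ + ‖u' k‖) < η :=
    (hs0.mul (hq'.norm.add hu'.norm)).eventually_lt_const (by simpa using hη)
  have e4 : ∀ᶠ k in atTop, s k < t := hs0.eventually_lt_const ht0
  obtain ⟨k, hk0, h1, h2, h3, h4⟩ := (hspos.and (e1.and (e2.and (e3.and e4)))).exists
  replace hk0 : 0 < s k := hk0
  have h1a := h1.trans_le (min_le_left _ _)
  have h1b := h1.trans_le (min_le_right _ _)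
  have hqk : 1 / 2 ≤ ‖q' k‖ := by
    have := norm_sub_norm_le q (q' k)
    rw [norm_sub_rev, hq] at this
    linarith
  have hpp : ‖p₀ + s k • q' k - (p₀ + s k • q)‖ = s k * ‖q' k - q‖ := by
    rw [add_sub_add_left_eq_sub, ← smul_sub, norm_smul, Real.norm_of_nonneg hk0.le]
  have hp : ‖p₀ + s k • q' k - p₀‖ = s k * ‖q' k‖ := by
    rw [add_sub_cancel_left, norm_smul, Real.norm_of_nonneg hk0.le]
  have hx : ‖x₀ + s k • u' k - x₀‖ = s k * ‖u' k‖ := by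
    rw [add_sub_cancel_left, norm_smul, Real.norm_of_nonneg hk0.le]
  obtain ⟨x, hxF, hxx⟩ := hF _ _ (p₀ + s k • q) (hmem k) (by rw [hp, hx, ← mul_add]; exact h3) (by
    rw [hpp, hp, hx, ← mul_add, mul_left_comm]
    refine mul_le_mul_of_nonneg_left ?_ hk0.le
    nlinarith [norm_nonneg (u' k)])
  have hstart : ‖x - x₀‖ ≤ C * s k := by
    have h5 := norm_sub_le_norm_sub_add_norm_sub x (x₀ + s k • u' k) x₀
    rw [hx] at h5
    rw [hpp] at hxx
    have h6 : s k * ‖u' k‖ ≤ s k * (‖u‖ + 1) := by gcongr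
    have h7 : κ * (s k * ‖q' k - q‖) ≤ κ * (s k * 1) := by gcongr; linarith
    rw [hC]
    linarith
  obtain ⟨j, hj⟩ := pow_unbounded_of_one_lt (t / s k) (show 1 < 1 + η by linarith)
  rw [div_lt_iff₀' hk0] at hj
  exact hF.exists_mem_of_mul_le hη hq (by rw [hC]; linarith [norm_nonneg u]) hC0 hk0
    ⟨x, hxF, hstart⟩ j t h4.le hj.le ((lt_div_iff₀' (by positivity)).1 htρ)

/-- Each ray estimate extends to a conical neighbourhood of the ray by one further move, so
compactness of the unit sphere makes it uniform. -/
theorem exists_forall_calm [FiniteDimensional ℝ P] (hF : IsLocallyMovable F p₀ x₀ κ η)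
    (hκ : 0 < κ) (hη : 0 < η) (h₀ : x₀ ∈ F p₀)
    (hD : ∀ q, ∃ u, u ∈ graphicalDerivative F p₀ x₀ q) :
    ∃ C > 0, ∃ ε > 0, ∀ p, ‖p - p₀‖ < ε → ∃ x ∈ F p, ‖x - x₀‖ ≤ C * ‖p - p₀‖ := by
  have : ProperSpace P := FiniteDimensional.proper_real P
  by_contra! hcon
  choose p hpε hp using fun k : ℕ => hcon ((k : ℝ) + 1) (by positivity) (1 / ((k : ℝ) + 1))
    Nat.one_div_pos_of_nat
  have hne : ∀ k, p k - p₀ ≠ 0 := fun k h => by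
    have := hp k x₀ (by rwa [sub_eq_zero.1 h])
    simp [h] at this
  set q : ℕ → P := fun k => ‖p k - p₀‖⁻¹ • (p k - p₀) with hq
  have hpq : ∀ k, p k = p₀ + ‖p k - p₀‖ • q k := fun k => by
    rw [hq, smul_inv_smul₀ (norm_ne_zero_iff.2 (hne k)), add_sub_cancel]
  obtain ⟨q', hq', φ, hφ, hlim⟩ := (isCompact_sphere (0 : P) 1).tendsto_subseq (x := q)
    (fun k => by simpa using norm_smul_inv_norm (𝕜 := ℝ) (hne k))
  replace hq' : ‖q'‖ = 1 := by simpa using hq'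
  obtain ⟨u, hu⟩ := hD q'
  obtain ⟨C, hC0, ρ, hρ, hray⟩ := hF.exists_forall_ray hκ hη hq' hu
  have ht : Tendsto (fun k => ‖p (φ k) - p₀‖) atTop (𝓝 0) :=
    squeeze_zero (fun k => norm_nonneg _) (fun k => (hpε (φ k)).le)
      (tendsto_one_div_add_atTop_nhds_zero_nat.comp hφ.tendsto_atTop)
  have e1 : ∀ᶠ k in atTop, ‖q (φ k) - q'‖ < η :=
    (tendsto_iff_norm_sub_tendsto_zero.1 hlim).eventually_lt_const hη
  have e2 : ∀ᶠ k in atTop, ‖p (φ k) - p₀‖ < ρ := ht.eventually_lt_const hρ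
  have e3 : ∀ᶠ k in atTop, (1 + C) * ‖p (φ k) - p₀‖ < η :=
    (ht.const_mul _).eventually_lt_const (by simpa using hη)
  have e4 : ∀ᶠ k in atTop, C + κ * η < ((φ k : ℕ) : ℝ) :=
    (tendsto_natCast_atTop_atTop.comp hφ.tendsto_atTop).eventually_gt_atTop _
  obtain ⟨k, h1, h2, h3, h4⟩ := (e1.and (e2.and (e3.and e4))).exists
  set t := ‖p (φ k) - p₀‖ with ht
  have ht0 : 0 < t := norm_pos_iff.2 (hne _)
  obtain ⟨x, hx, hxt⟩ := hray t ht0 h2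
  have hp1 : ‖p₀ + t • q' - p₀‖ = t := by
    rw [add_sub_cancel_left, norm_smul, hq', mul_one, Real.norm_of_nonneg ht0.le]
  have hp2 : ‖p₀ + t • q' - p (φ k)‖ = t * ‖q (φ k) - q'‖ := by
    rw [hpq (φ k), ← ht, add_sub_add_left_eq_sub, ← smul_sub, norm_smul,
      Real.norm_of_nonneg ht0.le, norm_sub_rev]
  have hp3 : ‖p₀ + t • q' - p (φ k)‖ ≤ η * t := by
    rw [hp2, mul_comm]; gcongr
  obtain ⟨x', hx', hxx'⟩ := hF _ x (p (φ k)) hx (by rw [hp1]; linarith)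
    (hp3.trans (by rw [hp1]; gcongr; linarith [norm_nonneg (x - x₀)]))
  have h5 := hp (φ k) x' hx'
  have h6 := norm_sub_le_norm_sub_add_norm_sub x' x x₀
  have h7 := mul_le_mul_of_nonneg_left hp3 hκ.le
  have h8 := mul_lt_mul_of_pos_right h4 ht0
  rw [← ht] at h5
  linarith

/-- If the shift is too large for a local move, `‖x - x₀‖` and `‖p - p₀‖` are bounded by multiples
of the shift, and the calm solution over `p` is close enough to `x`. -/
theorem hasAubinProperty [FiniteDimensional ℝ P] (hF : IsLocallyMovable F p₀ x₀ κ η)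
    (hκ : 0 < κ) (hη : 0 < η) (h₀ : x₀ ∈ F p₀)
    (hD : ∀ q, ∃ u, u ∈ graphicalDerivative F p₀ x₀ q) : HasAubinProperty F p₀ x₀ := by
  obtain ⟨C, hC, ε, hε, hcalm⟩ := hF.exists_forall_calm hκ hη h₀ hD
  set K := κ + 1 + C + (1 + C) / η with hK
  have hK0 : 0 ≤ K := by positivity
  refine ⟨h₀, K.toNNReal, min ε (η / 4), by positivity, fun p p' x hp hx hxF => ?_⟩
  rw [dist_eq_norm] at hp hx
  have hpε := hp.trans_le (min_le_left _ _)
  have hpη := hp.trans_le (min_le_right _ _)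
  have hxη := hx.trans_le (min_le_right _ _)
  suffices h : ∃ x' ∈ F p, ‖x' - x‖ ≤ K * ‖p' - p‖ by
    obtain ⟨x', hx', hle⟩ := h
    refine (Metric.infEDist_le_edist_of_mem hx').trans ?_
    rw [edist_dist, edist_dist, dist_comm, dist_eq_norm, dist_eq_norm,
      ← ENNReal.ofReal_coe_nnreal, Real.coe_toNNReal _ hK0, ← ENNReal.ofReal_mul hK0]
    exact ENNReal.ofReal_le_ofReal hle
  set d := ‖p' - p‖ with hd
  have hd0 : 0 ≤ d := norm_nonneg _
  have hCη : 0 ≤ (1 + C) / η := by positivity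
  have hCηd : 0 ≤ (1 + C) / η * d := by positivity
  have hfar : ‖x - x₀‖ + C * ‖p - p₀‖ ≤ K * d → ∃ x' ∈ F p, ‖x' - x‖ ≤ K * d := fun h => by
    obtain ⟨x', hx', hle⟩ := hcalm p hpε
    refine ⟨x', hx', ?_⟩
    have := norm_sub_le_norm_sub_add_norm_sub x' x₀ x
    rw [norm_sub_rev x₀ x] at this
    linarith
  have hpp : ‖p' - p₀‖ ≤ d + ‖p - p₀‖ := norm_sub_le_norm_sub_add_norm_sub _ _ _
  have hpp' : ‖p - p₀‖ ≤ d + ‖p' - p₀‖ := by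
    rw [hd, norm_sub_rev p' p]; exact norm_sub_le_norm_sub_add_norm_sub _ _ _
  rcases lt_or_ge (‖p' - p₀‖ + ‖x - x₀‖) η with h1 | h1
  · rcases le_or_gt d (η * (‖p' - p₀‖ + ‖x - x₀‖)) with h2 | h2
    · obtain ⟨x', hx', hle⟩ := hF p' x p hxF h1 h2
      refine ⟨x', hx', hle.trans ?_⟩
      rw [← hd]
      gcongr
      rw [hK]; linarith
    · refine hfar ?_
      have h3 : ‖p' - p₀‖ + ‖x - x₀‖ ≤ d / η := by
        rw [le_div_iff₀ hη]; linarith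
      have h4 : (1 + C) / η * d = d / η + C * (d / η) := by field_simp
      have h5 : C * ‖p - p₀‖ ≤ C * (d + d / η) := by
        gcongr; linarith [norm_nonneg (x - x₀)]
      rw [hK]
      have h6 : 0 ≤ κ * d := by positivity
      linarith [norm_nonneg (p' - p₀)]
  -- Here `p'` is far away: the radius `η / 4` makes `d` at least `η / 2`, which dominates both `‖p
  -- - p₀‖` and `‖x - x₀‖`.
  · refine hfar ?_
    have h5 : C * ‖p - p₀‖ ≤ C * d := by gcongr; linarith
    have h6 : 0 ≤ κ * d := by positivity
    rw [hK]
    linarith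

end IsLocallyMovable

end AubinProperty

/-! ### Comparison of the Euclidean product norm with sums of norms. -/

section ProductNorm

variable {P X Y : Type*} [SeminormedAddCommGroup P] [SeminormedAddCommGroup X]
  [SeminormedAddCommGroup Y]

theorem norm_prod₃_le (p : P) (x : X) (y : Y) :
    ‖WithLp.toLp 2 (WithLp.toLp 2 (p, x), y)‖ ≤ ‖p‖ + ‖x‖ + ‖y‖ := by
  refine abs_le_of_sq_le_sq' ?_ (by positivity) |>.2
  rw [WithLp.prod_norm_sq_eq_of_L2, WithLp.prod_norm_sq_eq_of_L2]
  change ‖p‖ ^ 2 + ‖x‖ ^ 2 + ‖y‖ ^ 2 ≤ _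
  have h1 : 0 ≤ ‖p‖ * ‖x‖ := by positivity
  have h2 : 0 ≤ ‖p‖ * ‖y‖ := by positivity
  have h3 : 0 ≤ ‖x‖ * ‖y‖ := by positivity
  nlinarith

theorem add_norm_le_two_mul_norm_prod₃ (p : P) (x : X) (y : Y) :
    ‖p‖ + ‖x‖ ≤ 2 * ‖WithLp.toLp 2 (WithLp.toLp 2 (p, x), y)‖ := by
  refine abs_le_of_sq_le_sq' ?_ (by positivity) |>.2
  rw [mul_pow, WithLp.prod_norm_sq_eq_of_L2, WithLp.prod_norm_sq_eq_of_L2]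
  change _ ≤ 2 ^ 2 * (‖p‖ ^ 2 + ‖x‖ ^ 2 + ‖y‖ ^ 2)
  nlinarith [sq_nonneg (‖p‖ - ‖x‖), sq_nonneg ‖y‖, sq_nonneg ‖x‖, sq_nonneg ‖p‖]

end ProductNorm

/-! ### Application to the graph of `M`. -/

section ImplicitMultifunction

variable {P X Y : Type*} [NormedAddCommGroup P] [InnerProductSpace ℝ P]
  [NormedAddCommGroup X] [InnerProductSpace ℝ X] [NormedAddCommGroup Y] [InnerProductSpace ℝ Y]

variable (P X Y) in
/-- The projection of `(p, x, y)` to `(p, 0, y)`. -/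
def dropMiddle : WithLp 2 (WithLp 2 (P × X) × Y) →ₗ[ℝ] WithLp 2 (WithLp 2 (P × X) × Y) where
  toFun z := WithLp.toLp 2 (WithLp.toLp 2 (z.fst.fst, 0), z.snd)
  map_add' a b := by
    simp [← WithLp.toLp_add]
  map_smul' c a := by
    simp [← WithLp.toLp_smul]

theorem dropMiddle_apply (z : WithLp 2 (WithLp 2 (P × X) × Y)) :
    dropMiddle P X Y z = WithLp.toLp 2 (WithLp.toLp 2 (z.fst.fst, 0), z.snd) := rfl

theorem isSymmetricProjection_dropMiddle : (dropMiddle P X Y).IsSymmetricProjection where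
  isIdempotentElem := rfl
  isSymmetric a b := by simp [dropMiddle_apply, WithLp.prod_inner_apply]

theorem norm_dropMiddle_le (z : WithLp 2 (WithLp 2 (P × X) × Y)) :
    ‖dropMiddle P X Y z‖ ≤ ‖z.fst.fst‖ + ‖z.snd‖ := by
  refine abs_le_of_sq_le_sq' ?_ (by positivity) |>.2
  rw [WithLp.prod_norm_sq_eq_of_L2, WithLp.prod_norm_sq_eq_of_L2]
  change ‖z.fst.fst‖ ^ 2 + ‖(0 : X)‖ ^ 2 + ‖z.snd‖ ^ 2 ≤ _
  rw [norm_zero]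
  nlinarith [norm_nonneg z.fst.fst, norm_nonneg z.snd]

theorem norm_snd_le_norm_dropMiddle (z : WithLp 2 (WithLp 2 (P × X) × Y)) :
    ‖z.snd‖ ≤ ‖dropMiddle P X Y z‖ := by
  refine abs_le_of_sq_le_sq' ?_ (norm_nonneg _) |>.2
  rw [WithLp.prod_norm_sq_eq_of_L2 (dropMiddle P X Y z)]
  exact le_add_of_nonneg_left (sq_nonneg _)

variable {M : WithLp 2 (P × X) → Set Y} {p₀ : P} {x₀ : X}

/-- The implicit multifunction satisfies a linear error estimate at points of the graph of `M` whose
residual is small compared to the distance to the reference point. -/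
theorem exists_mem_implicitMap_of_dirCoderivative [FiniteDimensional ℝ P] [FiniteDimensional ℝ X]
    [FiniteDimensional ℝ Y] (hM : IsClosed (mfGraph M))
    (hcod : ∀ (q : P) (u : X), (q, u) ≠ (0, 0) →
      0 ∈ graphicalDerivative M (WithLp.toLp 2 (p₀, x₀)) 0 (WithLp.toLp 2 (q, u)) →
      ∀ (q' : P) (v' : Y),
        WithLp.toLp 2 (q', 0) ∈
          dirCoderivative M (WithLp.toLp 2 (p₀, x₀)) 0 (WithLp.toLp 2 (q, u)) 0 v' →
        q' = 0 ∧ v' = 0) :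
    ∃ κ > 0, ∃ η > 0, ∀ p x y p', y ∈ M (WithLp.toLp 2 (p, x)) →
      ‖p - p₀‖ + ‖x - x₀‖ + ‖y‖ < η → ‖p - p'‖ + ‖y‖ ≤ η * (‖p - p₀‖ + ‖x - x₀‖) →
        ∃ x' ∈ implicitMap M p', ‖x' - x‖ ≤ κ * (‖p - p'‖ + ‖y‖) := by
  obtain ⟨κ, hκ, η, hη, H⟩ := exists_mem_apply_eq_of_dirNormalCone
    (A := (WithLp.sndₗ 2 ℝ (WithLp 2 (P × X)) Y)) (isSymmetricProjection_dropMiddle (P := P))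
    norm_snd_le_norm_dropMiddle hM (z₀ := WithLp.toLp 2 (WithLp.toLp 2 (p₀, x₀), 0)) (by
      intro w hw hw0 hAw μ hμ hPμ
      replace hAw : w.snd = 0 := hAw
      have hμx : μ.fst.snd = 0 := by
        have := congrArg (fun z => z.fst.snd) hPμ
        simpa [dropMiddle_apply] using this
      have hw' : w = WithLp.toLp 2 (WithLp.toLp 2 (w.fst.fst, w.fst.snd), 0) := by
        rw [← hAw]; rfl
      -- The double negation matches the sign in the coderivative, with `v' = -μ.snd`.
      have hμ' : μ = WithLp.toLp 2 (WithLp.toLp 2 (μ.fst.fst, 0), - -μ.snd) := by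
        rw [← hμx, neg_neg]; rfl
      rw [hμ', hw'] at hμ
      rw [hw'] at hw
      obtain ⟨h1, h2⟩ := hcod w.fst.fst w.fst.snd (fun h => hw0 (by
        rw [hw', h]; rfl)) hw μ.fst.fst (-μ.snd) hμ
      rw [hμ', h1, h2, neg_zero]; rfl)
  refine ⟨κ, hκ, min η (η / 2), by positivity, fun p x y p' hy hlt hle => ?_⟩
  have hsub : ∀ (a : P) (b : X) (c : Y), WithLp.toLp 2 (WithLp.toLp 2 (p, x), y) -
      WithLp.toLp 2 (WithLp.toLp 2 (a, b), c) =
        WithLp.toLp 2 (WithLp.toLp 2 (p - a, x - b), y - c) := fun _ _ _ => rfl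
  have hres := norm_dropMiddle_le (WithLp.toLp 2 (WithLp.toLp 2 (p, x), y) -
    WithLp.toLp 2 (WithLp.toLp 2 (p', x), (0 : Y)))
  rw [hsub] at hres
  simp only [sub_zero] at hres
  obtain ⟨z, hz, hPz, hzn⟩ := H (WithLp.toLp 2 (WithLp.toLp 2 (p, x), y)) hy
    (WithLp.toLp 2 (WithLp.toLp 2 (p', x), 0)) (sub_self (0 : Y))
    (by
      rw [hsub, sub_zero]
      exact (norm_prod₃_le _ _ _).trans_lt (hlt.trans_le (min_le_left _ _)))
    (by
      rw [hsub, hsub, sub_zero]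
      refine (hres.trans hle).trans ?_
      have h1 := add_norm_le_two_mul_norm_prod₃ (p - p₀) (x - x₀) y
      have h2 : min η (η / 2) * (‖p - p₀‖ + ‖x - x₀‖) ≤ η / 2 * (‖p - p₀‖ + ‖x - x₀‖) := by
        gcongr; exact min_le_right _ _
      nlinarith)
  have hz1 : z.fst.fst = p' := sub_eq_zero.1 (congrArg (fun z => z.fst.fst) hPz)
  have hz2 : z.snd = 0 := by
    have : z.snd - 0 = 0 := congrArg (fun z => z.snd) hPz
    rwa [sub_zero] at this
  refine ⟨z.fst.snd, ?_, ?_⟩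
  · change 0 ∈ M (WithLp.toLp 2 (p', z.fst.snd))
    rw [← hz1, ← hz2]
    exact hz
  · have h1 : ‖z.fst.snd - x‖ ≤ ‖z - WithLp.toLp 2 (WithLp.toLp 2 (p, x), y)‖ := by
      have h2 := WithLp.norm_fst_le _ (p := 2) (z - WithLp.toLp 2 (WithLp.toLp 2 (p, x), y))
      have h3 := WithLp.norm_snd_le _ (p := 2) (z.fst - WithLp.toLp 2 (p, x))
      exact h3.trans h2
    refine h1.trans (hzn.trans ?_)
    rw [hsub, sub_zero]
    exact mul_le_mul_of_nonneg_left hres hκ.le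

/-- A tangential sequence with values `t k • v k`, `v k → 0`, is corrected at fixed parameter to
exact solutions; the correction is `o(t k)` and leaves the direction unchanged. -/
theorem graphicalDerivative_implicitMap (h₀ : 0 ∈ M (WithLp.toLp 2 (p₀, x₀))) {κ η : ℝ}
    (hη : 0 < η)
    (H : ∀ p x y p', y ∈ M (WithLp.toLp 2 (p, x)) →
      ‖p - p₀‖ + ‖x - x₀‖ + ‖y‖ < η → ‖p - p'‖ + ‖y‖ ≤ η * (‖p - p₀‖ + ‖x - x₀‖) →
        ∃ x' ∈ implicitMap M p', ‖x' - x‖ ≤ κ * (‖p - p'‖ + ‖y‖)) (q : P) :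
    graphicalDerivative (implicitMap M) p₀ x₀ q =
      {u | 0 ∈ graphicalDerivative M (WithLp.toLp 2 (p₀, x₀)) 0 (WithLp.toLp 2 (q, u))} := by
  ext u
  rw [Set.mem_ofPred_eq, graphicalDerivative_iff, graphicalDerivative_iff]
  constructor
  · rintro ⟨t, q', u', ht, hq, hu, h⟩
    refine ⟨t, fun k => WithLp.toLp 2 (q' k, u' k), fun _ => 0, ht,
      ((WithLp.prod_continuous_toLp 2 P X).tendsto (q, u)).comp (hq.prodMk_nhds hu),
      tendsto_const_nhds, fun k => ?_⟩
    rw [smul_zero, add_zero]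
    exact h k
  · rintro ⟨t, w, v, ht, hw, hv, h⟩
    obtain ⟨ht0, htpos⟩ := tendsto_nhdsWithin_iff.1 ht
    have hq : Tendsto (fun k => (w k).fst) atTop (𝓝 q) :=
      ((WithLp.continuous_fst 2 P X).tendsto _).comp hw
    have hu : Tendsto (fun k => (w k).snd) atTop (𝓝 u) :=
      ((WithLp.continuous_snd 2 P X).tendsto _).comp hw
    -- In the zero direction the residual need not be small relative to the distance, but the
    -- constant sequence at the reference point suffices.
    rcases eq_or_ne (q, u) (0, 0) with hqu | hqu
    · obtain ⟨rfl, rfl⟩ := Prod.mk.inj hqu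
      refine ⟨t, fun _ => 0, fun _ => 0, ht, tendsto_const_nhds, tendsto_const_nhds, fun k => ?_⟩
      simpa [implicitMap] using h₀
    have hpos : 0 < ‖q‖ + ‖u‖ := by
      rcases eq_or_ne q 0 with rfl | hq0
      · have : u ≠ 0 := fun h => hqu (by rw [h])
        positivity
      · positivity
    have e1 : ∀ᶠ k in atTop, t k * ‖(w k).fst‖ + t k * ‖(w k).snd‖ + t k * ‖v k‖ < η :=
      (((ht0.mul hq.norm).add (ht0.mul hu.norm)).add (ht0.mul hv.norm)).eventually_lt_const
        (by simpa using hη)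
    have e2 : ∀ᶠ k in atTop, ‖v k‖ < η * (‖(w k).fst‖ + ‖(w k).snd‖) :=
      hv.norm.eventually_lt ((hq.norm.add hu.norm).const_mul η) (by rw [norm_zero]; positivity)
    obtain ⟨N, hN⟩ := eventually_atTop.1 (htpos.and (e1.and e2))
    have hx : ∀ k, ∃ x' ∈ implicitMap M (p₀ + t (k + N) • (w (k + N)).fst),
        ‖x' - (x₀ + t (k + N) • (w (k + N)).snd)‖ ≤ κ * (t (k + N) * ‖v (k + N)‖) := fun k => by
      obtain ⟨hk, h1, h2⟩ := hN (k + N) (Nat.le_add_left _ _)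
      replace hk : 0 < t (k + N) := hk
      have hmem : t (k + N) • v (k + N) ∈ M (WithLp.toLp 2 (p₀ + t (k + N) • (w (k + N)).fst,
          x₀ + t (k + N) • (w (k + N)).snd)) := by
        have := h (k + N)
        rw [zero_add] at this
        exact this
      have := H _ _ _ (p₀ + t (k + N) • (w (k + N)).fst) hmem
      simp only [add_sub_cancel_left, sub_self, norm_zero, zero_add, norm_smul,
        Real.norm_of_nonneg hk.le] at this
      refine this h1 ?_
      rw [← mul_add, mul_left_comm]
      exact mul_le_mul_of_nonneg_left h2.le hk.le
    choose x hxS hxn using hx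
    have hs := tendsto_add_atTop_nat N
    refine ⟨fun k => t (k + N), fun k => (w (k + N)).fst, fun k => (t (k + N))⁻¹ • (x k - x₀),
      ht.comp hs, hq.comp hs, ?_, fun k => ?_⟩
    · have hd : Tendsto (fun k => (t (k + N))⁻¹ • (x k - x₀) - (w (k + N)).snd) atTop (𝓝 0) := by
        refine squeeze_zero_norm (a := fun k => κ * ‖v (k + N)‖) (fun k => ?_) ?_
        · have hk : 0 < t (k + N) := (hN (k + N) (Nat.le_add_left _ _)).1
          have h1 : (t (k + N))⁻¹ • (x k - x₀) - (w (k + N)).snd =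
              (t (k + N))⁻¹ • (x k - (x₀ + t (k + N) • (w (k + N)).snd)) := by
            rw [← sub_sub, smul_sub _ (x k - x₀), inv_smul_smul₀ hk.ne']
          rw [h1, norm_smul, norm_inv, Real.norm_of_nonneg hk.le, inv_mul_le_iff₀ hk]
          exact (hxn k).trans_eq (mul_left_comm _ _ _)
        · simpa using (hv.norm.comp hs).const_mul κ
      simpa using hd.add (hu.comp hs)
    · have hk : 0 < t (k + N) := (hN (k + N) (Nat.le_add_left _ _)).1
      rw [smul_inv_smul₀ hk.ne', add_sub_cancel]
      exact hxS k

end ImplicitMultifunction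

theorem mainTheorem9 (l n m : ℕ)
    (M : WithLp 2 (EuclideanSpace ℝ (Fin l) × EuclideanSpace ℝ (Fin n)) →
      Set (EuclideanSpace ℝ (Fin m)))
    (hM : IsClosed (mfGraph M))
    (p₀ : EuclideanSpace ℝ (Fin l)) (x₀ : EuclideanSpace ℝ (Fin n))
    (h₀ : 0 ∈ M (WithLp.toLp 2 (p₀, x₀)))
    (hDM : ∀ q : EuclideanSpace ℝ (Fin l), ∃ u : EuclideanSpace ℝ (Fin n),
      0 ∈ graphicalDerivative M (WithLp.toLp 2 (p₀, x₀)) 0 (WithLp.toLp 2 (q, u)))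
    (hcod : ∀ (q : EuclideanSpace ℝ (Fin l)) (u : EuclideanSpace ℝ (Fin n)), (q, u) ≠ (0, 0) →
      0 ∈ graphicalDerivative M (WithLp.toLp 2 (p₀, x₀)) 0 (WithLp.toLp 2 (q, u)) →
      ∀ (q' : EuclideanSpace ℝ (Fin l)) (v' : EuclideanSpace ℝ (Fin m)),
        WithLp.toLp 2 (q', 0) ∈
          dirCoderivative M (WithLp.toLp 2 (p₀, x₀)) 0 (WithLp.toLp 2 (q, u)) 0 v' →
        q' = 0 ∧ v' = 0) :
    HasAubinProperty (implicitMap M) p₀ x₀ ∧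
      ∀ q : EuclideanSpace ℝ (Fin l),
        graphicalDerivative (implicitMap M) p₀ x₀ q =
          {u | 0 ∈ graphicalDerivative M (WithLp.toLp 2 (p₀, x₀)) 0 (WithLp.toLp 2 (q, u))} := by
  obtain ⟨κ, hκ, η, hη, H⟩ := exists_mem_implicitMap_of_dirCoderivative hM hcod
  have hD := graphicalDerivative_implicitMap h₀ hη H
  have hF : IsLocallyMovable (implicitMap M) p₀ x₀ κ η := fun p x p' hx h1 h2 => by
    simpa using H p x 0 p' hx (by simpa using h1) (by simpa using h2)
  exact ⟨hF.hasAubinProperty hκ hη h₀ fun q => by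
    obtain ⟨u, hu⟩ := hDM q
    exact ⟨u, (hD q).ge hu⟩, hD⟩
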